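/- **Setting.** Let $n,d\in\mathbb N$ with $d<n$ be such that a $d$-regular graph on node set $[n]$ exists (equivalently, $dn$ is even), and let $G$ be uniformly distributed over the $d$-regular graphs on $[n]$. Two graphs on $[n]$ are node neighbors if they differ only in edges incident to a single node. Two distributions $P,Q$ are $(\varepsilon,\delta)$-indistinguishable if $P(S)\le e^{\varepsilon}Q(S)+\delta$ and $Q(S)\le e^{\varepsilon}P(S)+\delta$ for every event $S$. A randomized algorithm $\mathcal A$ on graphs with node set $[n]$ is $(\varepsilon,\delta)$-LNDP (noninteractive local node differential privacy) if there are a distribution of public randomness $\rho$, local randomizers $\mathcal R_{1,\rho},\dots,\mathcal R_{n,\rho}$ with independent local randomness, and a randomized postprocessing $\mathcal P$ such that (i) for every graph $H$ on $[n]$, $\mathcal A(H)$ has the law of $\mathcal P\bigl(\mathcal R_{1,\rho}(N_1^H),\dots,\mathcal R_{n,\rho}(N_n^H)\bigr)$, where $N_i^H$ is the neighborhood of node $i$ in $H$; and (ii) for every setting of $\rho$ and all node-neighboring $H,H'$, the vectors of reports $\bigl(\mathcal R_{i,\rho}(N_i^{H})\bigr)_{i}$ and $\bigl(\mathcal R_{i,\rho}(N_i^{H'})\bigr)_{i}$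 are $(\varepsilon,\delta)$-indistinguishable. Write $B(P,Q)=-\ln\int\sqrt{pq}$ for the Bhattacharyya distance (where $p,q$ are the densities of $P,Q$ with respect to a common dominating measure), $d_{\mathrm{TV}}(P,Q)=\sup_S|P(S)-Q(S)|$ for the total variation distance, and $\varnothing$ for the empty graph on $[n]$; in the pair $(G,\mathcal A(\varnothing))$ the output $\mathcal A(\varnothing)$ is independent of $G$. **Lemma (random $d$-regular graphs are indistinguishable from the empty graph).** Let $\varepsilon>0$ and $\delta\ge 0$ with $\tilde\delta:=d\delta e^{d\varepsilon}<1$, and let $\mathcal A$ be $(\varepsilon,\delta)$-LNDP. Then $$B\bigl((G,\mathcal A(G)),(G,\mathcal A(\varnothing))\bigr)\;\le\;\ln\!\left(\frac{e^{d\varepsilon/2}+e^{-d\varepsilon/2}}{2(1-\tilde\delta)}\right)\cdot\frac{1}{1-\frac dn}.$$ Furthermore, if $d\le n/2$ then, as $d\varepsilon\to0$ and $d\delta\to0$, $$B\bigl((G,\mathcal A(G)),(G,\mathcal A(\varnothing))\bigr)=O\bigl((d\varepsilon)^2+d\delta\bigr)\quad\text{and}\quad d_{\mathrm{TV}}\bigl((G,\mathcal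 A(G)),(G,\mathcal A(\varnothing))\bigr)=O\bigl(d\varepsilon+\sqrt{d\delta}\bigr).$$ That is, there are absolute constants $c,C>0$ such that whenever $d\le n/2$, $\varepsilon>0$, $\delta\ge0$, $d\varepsilon\le c$, $d\delta\le c$ and $\mathcal A$ is $(\varepsilon,\delta)$-LNDP, the Bhattacharyya distance is at most $C\bigl((d\varepsilon)^2+d\delta\bigr)$ and the total variation distance is at most $C\bigl(d\varepsilon+\sqrt{d\delta}\bigr)$. -/

import Mathlib

open MeasureTheory ProbabilityTheory
open scoped ENNReal

universe u v w

noncomputable section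

namespace LNDP

/-- Two graphs on node set `[n]` are node neighbors if, for some node `i`, they differ only in
edges incident to `i`. -/
def NodeNeighbors {n : ℕ} (G G' : SimpleGraph (Fin n)) : Prop :=
  ∃ i : Fin n, ∀ j k : Fin n, j ≠ i → k ≠ i → (G.Adj j k ↔ G'.Adj j k)

/-- `(ε, δ)`-indistinguishability of two probability distributions. -/
def Indistinguishable {Y : Type*} [MeasurableSpace Y] (ε δ : ℝ) (P Q : Measure Y) : Prop :=
  ∀ S : Set Y, MeasurableSet S →
    P S ≤ ENNReal.ofReal (Real.exp ε) * Q S + ENNReal.ofReal δ ∧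
    Q S ≤ ENNReal.ofReal (Real.exp ε) * P S + ENNReal.ofReal δ

/-- The joint distribution of the independent reports of all nodes on the graph `G`, for the
setting `ρ` of the public randomness: node `i` runs its randomizer on its neighborhood. -/
def reports {n : ℕ} {Ω : Type*} [MeasurableSpace Ω] {Z : Fin n → Type*}
    [∀ i, MeasurableSpace (Z i)] (R : ∀ i, Set (Fin n) → Kernel Ω (Z i))
    (ρ : Ω) (G : SimpleGraph (Fin n)) : Measure (∀ i, Z i) :=
  Measure.pi fun i => R i (G.neighborSet i) ρ

/-- A randomized algorithm `A` on graphs with node set `[n]` (a Markov kernel into the output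
space `Y`) is (noninteractively) `(ε, δ)`-locally node differentially private if there are a
distribution `μ` of public randomness, local randomizers `R i`, which see the public randomness and
a set of neighbors, and a postprocessing algorithm `P`, such that

* running `P` on the reports of all nodes, for `ρ ∼ μ`, has the law of `A`, on every graph;
* for every setting `ρ` of the public randomness, the joint distributions of the reports on any two
  node-neighboring graphs are `(ε, δ)`-indistinguishable. -/
def IsLNDP {n : ℕ} {Y : Type w} [MeasurableSpace Y] (ε δ : ℝ)
    (A : Kernel (SimpleGraph (Fin n)) Y) : Prop :=
  ∃ (Ω : Type u) (_ : MeasurableSpace Ω) (μ : Measure Ω)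
    (Z : Fin n → Type v) (_ : ∀ i, MeasurableSpace (Z i))
    (R : ∀ i, Set (Fin n) → Kernel Ω (Z i)) (P : Kernel (∀ i, Z i) Y),
    IsProbabilityMeasure μ ∧ (∀ i N, IsMarkovKernel (R i N)) ∧ IsMarkovKernel P ∧
    (∀ (G : SimpleGraph (Fin n)) (S : Set Y), MeasurableSet S →
      A G S = ∫⁻ ρ, ∫⁻ z, P z S ∂(reports R ρ G) ∂μ) ∧
    (∀ G G' : SimpleGraph (Fin n), NodeNeighbors G G' →
      ∀ ρ : Ω, Indistinguishable ε δ (reports R ρ G) (reports R ρ G'))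

/-- Hellinger affinity (Bhattacharyya coefficient) `∫ √(p q)`, where `p`, `q` are the densities of
`P`, `Q` with respect to the dominating measure `P + Q`. -/
def hellingerAffinity {X : Type*} [MeasurableSpace X] (P Q : Measure X) : ℝ≥0∞ :=
  ∫⁻ x, (P.rnDeriv (P + Q) x * Q.rnDeriv (P + Q) x) ^ (1 / 2 : ℝ) ∂(P + Q)

/-- Bhattacharyya distance `-ln ∫ √(p q)`; it is `⊤` for mutually singular distributions. -/
def bhattDist {X : Type*} [MeasurableSpace X] (P Q : Measure X) : EReal :=
  -ENNReal.log (hellingerAffinity P Q)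

/-- Total variation distance of probability distributions. -/
def tvDist {X : Type*} [MeasurableSpace X] (P Q : Measure X) : ℝ :=
  ⨆ S : {S : Set X // MeasurableSet S}, |P.real S - Q.real S|

open Classical in
/-- The uniform distribution over `d`-regular graphs on node set `[n]`. -/
def regularGraphLaw (n d : ℕ) : Measure (SimpleGraph (Fin n)) :=
  uniformOn {G | G.IsRegularOfDegree d}

/-- The law of `(G, A(G))` for `G` uniform over `d`-regular graphs. -/
def pairLaw {n : ℕ} {Y : Type*} [MeasurableSpace Y] (d : ℕ)
    (A : Kernel (SimpleGraph (Fin n)) Y) : Measure (SimpleGraph (Fin n) × Y) :=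
  (regularGraphLaw n d).compProd A

/-- The law of `(G, A(∅))` for `G` uniform over `d`-regular graphs: the algorithm is run on the
empty graph, independently of `G`. -/
def pairLawEmpty {n : ℕ} {Y : Type*} [MeasurableSpace Y] (d : ℕ)
    (A : Kernel (SimpleGraph (Fin n)) Y) : Measure (SimpleGraph (Fin n) × Y) :=
  (regularGraphLaw n d).prod (A ⊥)

end LNDP

end

/-! The affinity ∫√(pq) is multiplicative over independent reports, so its negative logarithm is a
sum of costs, one per node. Fix a `d`-set `S` and the complete bipartite graph between `S` and its
complement. Deleting the edges at the nodes of `S`, one node at a time, reaches the empty graph in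
`d` steps, so group privacy bounds the total cost by the logarithm `L` in the claim. Every node
outside `S` sees exactly `S`, so the `n - d` costs of seeing `S` instead of nothing sum to at most
`L` (`le_prod_hellingerAffinity`).

After a uniform relabeling, a node of a regular graph together with its neighborhood is a uniform
pair `(i, S)` with `i ∉ S`, so its expected cost is at most `L / (n - d)`. By linearity of
expectation the dependence between neighborhoods is harmless, and the expected total is `n L / (n -
d) = L / (1 - d / n)` (`sum_regular_le`). Jensen's inequality then bounds the mean affinity from
below.

Public randomness and postprocessing are absorbed by the variational formula: twice the affinity is
the infimum of `∫ F dP + ∫ H dQ` over `F H ≥ 1`. The objective is linear in `(P, Q)`, hence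
compatible with mixing over `ρ` and averaging over `G`, and the constraint survives a Markov kernel.
-/

namespace LNDP

/-! ### Hellinger affinity: variational formula and total variation. -/

section Affinity

lemma two_mul_sqrt_mul_le (a b : ℝ≥0∞) : 2 * (a * b) ^ (1 / 2 : ℝ) ≤ a + b := by
  have h := ENNReal.young_inequality (a ^ (1 / 2 : ℝ)) (b ^ (1 / 2 : ℝ)) Real.HolderConjugate.two_two
  rw [← ENNReal.mul_rpow_of_nonneg _ _ (by norm_num), ← ENNReal.rpow_mul, ← ENNReal.rpow_mul] at h
  norm_num at h
  rw [← ENNReal.add_div, ENNReal.le_div_iff_mul_le (by simp) (by simp)] at h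
  rw [mul_comm]
  simpa using h

lemma lintegral_sqrt_mul_le {α : Type*} [MeasurableSpace α] (μ : Measure α) {f g : α → ℝ≥0∞}
    (hf : AEMeasurable f μ) (hg : AEMeasurable g μ) :
    ∫⁻ x, (f x * g x) ^ (1 / 2 : ℝ) ∂μ ≤ (∫⁻ x, f x ∂μ) ^ (1 / 2 : ℝ) * (∫⁻ x, g x ∂μ) ^ (1 / 2 : ℝ) := by
  have h := ENNReal.lintegral_mul_le_Lp_mul_Lq μ Real.HolderConjugate.two_two
    (hf.pow_const (1 / 2 : ℝ)) (hg.pow_const (1 / 2 : ℝ))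
  simp only [Pi.mul_apply, ← ENNReal.rpow_mul] at h
  norm_num at h
  simp only [ENNReal.mul_rpow_of_nonneg _ _ (show (0 : ℝ) ≤ 1 / 2 by norm_num)]
  exact h

lemma sqrt_mul_self (a : ℝ≥0∞) : (a * a) ^ (1 / 2 : ℝ) = a := by
  rw [← sq, ← ENNReal.rpow_natCast, ← ENNReal.rpow_mul]
  norm_num

variable {X : Type*} [MeasurableSpace X] (P Q : Measure X)

lemma withDensity_rnDeriv_add_left [IsFiniteMeasure P] [IsFiniteMeasure Q] :
    (P + Q).withDensity (P.rnDeriv (P + Q)) = P :=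
  Measure.withDensity_rnDeriv_eq _ _ (Measure.absolutelyContinuous_of_le (Measure.le_add_right le_rfl))

lemma withDensity_rnDeriv_add_right [IsFiniteMeasure P] [IsFiniteMeasure Q] :
    (P + Q).withDensity (Q.rnDeriv (P + Q)) = Q :=
  Measure.withDensity_rnDeriv_eq _ _ (Measure.absolutelyContinuous_of_le (Measure.le_add_left le_rfl))

/-- The Hellinger affinity may be computed with respect to any dominating measure. -/
lemma hellingerAffinity_eq_of_withDensity [IsFiniteMeasure P] [IsFiniteMeasure Q] {ν : Measure X}
    {p q : X → ℝ≥0∞} (hp : Measurable p) (hq : Measurable q)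
    (hP : ν.withDensity p = P) (hQ : ν.withDensity q = Q) :
    hellingerAffinity P Q = ∫⁻ x, (p x * q x) ^ (1 / 2 : ℝ) ∂ν := by
  have hadd : P + Q = ν.withDensity (p + q) := by
    rw [withDensity_add_left hp, hP, hQ]
  -- Chain rule for densities. Both densities then carry the factor `p + q`, which leaves the square
  -- root and cancels against the change of measure.
  have key : ∀ {M : Measure X} [IsFiniteMeasure M] {m : X → ℝ≥0∞}, Measurable m →
      ν.withDensity m = M → (P + Q).withDensity (M.rnDeriv (P + Q)) = M →
      m =ᵐ[ν] (p + q) * M.rnDeriv (P + Q) := by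
    intro M _ m hm hM hMr
    have hr := Measure.measurable_rnDeriv M (P + Q)
    refine (withDensity_eq_iff hm.aemeasurable ((hp.add hq).mul hr).aemeasurable ?_).1 ?_
    · rw [← setLIntegral_univ, ← withDensity_apply _ MeasurableSet.univ, hM]
      exact measure_ne_top _ _
    · rw [hM, withDensity_mul _ (hp.add hq) hr, ← hadd, hMr]
  have h1 := key hp hP (withDensity_rnDeriv_add_left P Q)
  have h2 := key hq hQ (withDensity_rnDeriv_add_right P Q)
  unfold hellingerAffinity
  set r := P.rnDeriv (P + Q) with hr
  set s := Q.rnDeriv (P + Q) with hs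
  have hrm : Measurable r := Measure.measurable_rnDeriv _ _
  have hsm : Measurable s := Measure.measurable_rnDeriv _ _
  rw [hadd, lintegral_withDensity_eq_lintegral_mul _ (hp.add hq) (by fun_prop)]
  refine lintegral_congr_ae ?_
  filter_upwards [h1, h2] with x hx1 hx2
  rw [hx1, hx2]
  simp only [Pi.mul_apply]
  rw [mul_mul_mul_comm, ENNReal.mul_rpow_of_nonneg (_ * _) (_ * _) (by norm_num : (0 : ℝ) ≤ 1 / 2),
    sqrt_mul_self]

/-- Everywhere finite densities of `P` and `Q` with respect to `P + Q`. -/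
lemma exists_densities [IsFiniteMeasure P] [IsFiniteMeasure Q] :
    ∃ p q : X → ℝ≥0∞, Measurable p ∧ Measurable q ∧ (∀ x, p x ≠ ∞) ∧ (∀ x, q x ≠ ∞) ∧
      (P + Q).withDensity p = P ∧ (P + Q).withDensity q = Q := by
  have key : ∀ (M : Measure X) [IsFiniteMeasure M],
      (P + Q).withDensity (M.rnDeriv (P + Q)) = M →
      (P + Q).withDensity (fun x => ((M.rnDeriv (P + Q) x).toNNReal : ℝ≥0∞)) = M := by
    intro M _ h
    conv_rhs => rw [← h]
    refine withDensity_congr_ae ?_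
    filter_upwards [Measure.rnDeriv_lt_top M (P + Q)] with x hx
    exact ENNReal.coe_toNNReal hx.ne
  refine ⟨_, _, ?_, ?_, fun x => ENNReal.coe_ne_top, fun x => ENNReal.coe_ne_top,
    key P (withDensity_rnDeriv_add_left P Q), key Q (withDensity_rnDeriv_add_right P Q)⟩
  · exact (Measure.measurable_rnDeriv _ _).ennreal_toNNReal.coe_nnreal_ennreal
  · exact (Measure.measurable_rnDeriv _ _).ennreal_toNNReal.coe_nnreal_ennreal

lemma hellingerAffinity_le_one [IsProbabilityMeasure P] [IsProbabilityMeasure Q] :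
    hellingerAffinity P Q ≤ 1 := by
  obtain ⟨p, q, hp, hq, -, -, hP, hQ⟩ := exists_densities P Q
  rw [hellingerAffinity_eq_of_withDensity P Q hp hq hP hQ]
  refine (lintegral_sqrt_mul_le _ hp.aemeasurable hq.aemeasurable).trans ?_
  rw [← setLIntegral_univ, ← setLIntegral_univ (f := q), ← withDensity_apply _ MeasurableSet.univ,
    ← withDensity_apply _ MeasurableSet.univ, hP, hQ]
  simp

/-- Pointwise AM-GM: `p F + q H ≥ 2 √(p q F H)`. The right-hand side is linear in `(P, Q)`, which is
what makes mixtures tractable. -/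
lemma two_mul_hellingerAffinity_le [IsFiniteMeasure P] [IsFiniteMeasure Q] {F H : X → ℝ≥0∞}
    (hF : Measurable F) (hH : Measurable H) (hFH : ∀ x, 1 ≤ F x * H x) :
    2 * hellingerAffinity P Q ≤ ∫⁻ x, F x ∂P + ∫⁻ x, H x ∂Q := by
  obtain ⟨p, q, hp, hq, -, -, hP, hQ⟩ := exists_densities P Q
  rw [hellingerAffinity_eq_of_withDensity P Q hp hq hP hQ]
  set ν := P + Q
  rw [← hP, ← hQ, lintegral_withDensity_eq_lintegral_mul _ hp hF,
    lintegral_withDensity_eq_lintegral_mul _ hq hH, ← lintegral_add_left (hp.mul hF),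
    ← lintegral_const_mul _ (by fun_prop)]
  refine lintegral_mono fun x => ?_
  refine le_trans ?_ (two_mul_sqrt_mul_le _ _)
  refine mul_le_mul_right (ENNReal.rpow_le_rpow ?_ (by norm_num)) _
  simp only [Pi.mul_apply]
  calc p x * q x = p x * q x * 1 := by rw [mul_one]
    _ ≤ p x * q x * (F x * H x) := by gcongr; exact hFH x
    _ = _ := by ring

lemma sqrt_add_le (a b : ℝ≥0∞) : (a + b) ^ (1 / 2 : ℝ) ≤ a ^ (1 / 2 : ℝ) + b ^ (1 / 2 : ℝ) :=
  ENNReal.rpow_add_le_add_rpow _ _ (by norm_num) (by norm_num)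

/-- The optimal `F = √(q / p)` is ill-behaved where a density vanishes; adding `η` to both densities
repairs this at the cost of `√(η a)`. -/
lemma mul_sqrt_div_le {a b η : ℝ≥0∞} (ha : a ≠ ∞) (hη : η ≠ 0) (hη' : η ≠ ∞) :
    a * ((b + η) / (a + η)) ^ (1 / 2 : ℝ) ≤
      (a * b) ^ (1 / 2 : ℝ) + η ^ (1 / 2 : ℝ) * a ^ (1 / 2 : ℝ) := by
  have h0 : a + η ≠ 0 := by simp [hη]
  have ht : a + η ≠ ∞ := by simp [ha, hη']
  have h12 : (0 : ℝ) ≤ 1 / 2 := by norm_num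
  calc a * ((b + η) / (a + η)) ^ (1 / 2 : ℝ)
      = (a * a) ^ (1 / 2 : ℝ) * ((b + η) / (a + η)) ^ (1 / 2 : ℝ) := by rw [sqrt_mul_self]
    _ = (a * (b + η) * (a / (a + η))) ^ (1 / 2 : ℝ) := by
        rw [← ENNReal.mul_rpow_of_nonneg _ _ h12, ENNReal.div_eq_inv_mul, ENNReal.div_eq_inv_mul]
        ring_nf
    _ ≤ (a * (b + η) * 1) ^ (1 / 2 : ℝ) := by
        gcongr
        exact ENNReal.div_le_of_le_mul (by simp)
    _ = (a * b + η * a) ^ (1 / 2 : ℝ) := by ring_nf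
    _ ≤ _ := by
        rw [← ENNReal.mul_rpow_of_nonneg _ _ h12]
        exact sqrt_add_le _ _

/-- The bound `two_mul_hellingerAffinity_le` is attained up to an arbitrarily small error. -/
lemma exists_near_optimal [IsFiniteMeasure P] [IsFiniteMeasure Q] {κ : ℝ≥0∞} (hκ : κ ≠ 0) :
    ∃ F H : X → ℝ≥0∞, Measurable F ∧ Measurable H ∧ (∀ x, 1 ≤ F x * H x) ∧
      ∫⁻ x, F x ∂P + ∫⁻ x, H x ∂Q ≤ 2 * hellingerAffinity P Q + κ := by
  obtain ⟨p, q, hp, hq, hpt, hqt, hP, hQ⟩ := exists_densities P Q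
  rw [hellingerAffinity_eq_of_withDensity P Q hp hq hP hQ]
  set ν := P + Q with hν
  set C : ℝ≥0∞ := ∫⁻ x, p x ^ (1 / 2 : ℝ) ∂ν + ∫⁻ x, q x ^ (1 / 2 : ℝ) ∂ν with hC
  have hfin : ∀ (M : Measure X) [IsFiniteMeasure M] (m : X → ℝ≥0∞), Measurable m →
      ν.withDensity m = M → ∫⁻ x, m x ^ (1 / 2 : ℝ) ∂ν ≠ ∞ := by
    intro M _ m hm hM
    have h := lintegral_sqrt_mul_le ν hm.aemeasurable (aemeasurable_const (b := (1 : ℝ≥0∞)))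
    simp only [mul_one] at h
    refine ne_top_of_le_ne_top ?_ h
    refine ENNReal.mul_ne_top (ENNReal.rpow_ne_top_of_nonneg (by norm_num) ?_)
      (ENNReal.rpow_ne_top_of_nonneg (by norm_num) (by simp))
    rw [← setLIntegral_univ, ← withDensity_apply _ MeasurableSet.univ, hM]
    exact measure_ne_top _ _
  have hCt : C ≠ ∞ := ENNReal.add_ne_top.2 ⟨hfin P p hp hP, hfin Q q hq hQ⟩
  obtain ⟨η, hη0, hηt, hη⟩ : ∃ η : ℝ≥0∞, η ≠ 0 ∧ η ≠ ∞ ∧ η ^ (1 / 2 : ℝ) * C ≤ κ := by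
    obtain ⟨t, ht0, ht⟩ := ENNReal.exists_nnreal_pos_mul_lt hCt hκ
    refine ⟨(t : ℝ≥0∞) ^ 2, by simpa using ht0.ne', by simp, ?_⟩
    rw [← ENNReal.rpow_natCast, ← ENNReal.rpow_mul]
    norm_num
    exact ht.le
  have hpη : ∀ x, p x + η ≠ 0 ∧ p x + η ≠ ∞ := fun x => ⟨by simp [hη0], by simp [hpt x, hηt]⟩
  have hqη : ∀ x, q x + η ≠ 0 ∧ q x + η ≠ ∞ := fun x => ⟨by simp [hη0], by simp [hqt x, hηt]⟩
  refine ⟨fun x => ((q x + η) / (p x + η)) ^ (1 / 2 : ℝ),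
    fun x => ((p x + η) / (q x + η)) ^ (1 / 2 : ℝ), by fun_prop, by fun_prop, fun x => ?_, ?_⟩
  · rw [← ENNReal.mul_rpow_of_nonneg _ _ (by norm_num),
      show (q x + η) / (p x + η) * ((p x + η) / (q x + η)) = 1 from ?_]
    · simp
    · rw [div_eq_mul_inv, div_eq_mul_inv, mul_comm, mul_mul_mul_comm,
        mul_comm (q x + η)⁻¹, mul_mul_mul_comm, ENNReal.mul_inv_cancel (hqη x).1 (hqη x).2,
        ENNReal.mul_inv_cancel (hpη x).1 (hpη x).2, one_mul]
  · rw [← hP, ← hQ, lintegral_withDensity_eq_lintegral_mul _ hp (by fun_prop),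
      lintegral_withDensity_eq_lintegral_mul _ hq (by fun_prop)]
    simp only [Pi.mul_apply]
    calc _ ≤ ∫⁻ x, ((p x * q x) ^ (1 / 2 : ℝ) + η ^ (1 / 2 : ℝ) * p x ^ (1 / 2 : ℝ)) ∂ν +
          ∫⁻ x, ((p x * q x) ^ (1 / 2 : ℝ) + η ^ (1 / 2 : ℝ) * q x ^ (1 / 2 : ℝ)) ∂ν := by
          gcongr with x x
          · exact mul_sqrt_div_le (hpt x) hη0 hηt
          · rw [mul_comm (p x)]
            exact mul_sqrt_div_le (hqt x) hη0 hηt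
      _ = 2 * ∫⁻ x, (p x * q x) ^ (1 / 2 : ℝ) ∂ν + η ^ (1 / 2 : ℝ) * C := by
          rw [lintegral_add_left (by fun_prop), lintegral_add_left (by fun_prop),
            lintegral_const_mul _ (by fun_prop), lintegral_const_mul _ (by fun_prop), hC]
          ring
      _ ≤ _ := by gcongr

/-- Cauchy–Schwarz on `S` and on its complement: coarsening to a two-point space does not decrease
the affinity. -/
lemma hellingerAffinity_le_sqrt_add_sqrt [IsFiniteMeasure P] [IsFiniteMeasure Q] {S : Set X}
    (hS : MeasurableSet S) :
    hellingerAffinity P Q ≤ P S ^ (1 / 2 : ℝ) * Q S ^ (1 / 2 : ℝ) +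
      P Sᶜ ^ (1 / 2 : ℝ) * Q Sᶜ ^ (1 / 2 : ℝ) := by
  obtain ⟨p, q, hp, hq, hpt, hqt, hP, hQ⟩ := exists_densities P Q
  rw [hellingerAffinity_eq_of_withDensity P Q hp hq hP hQ]
  set ν := P + Q with hν
  rw [← lintegral_add_compl _ hS, ← hP, ← hQ, withDensity_apply _ hS, withDensity_apply _ hS,
    withDensity_apply _ hS.compl, withDensity_apply _ hS.compl]
  gcongr <;> exact lintegral_sqrt_mul_le _ hp.aemeasurable hq.aemeasurable

lemma tvDist_le_sqrt [IsProbabilityMeasure P] [IsProbabilityMeasure Q] :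
    tvDist P Q ≤ √(1 - (hellingerAffinity P Q).toReal ^ 2) := by
  unfold tvDist
  have : Nonempty {S : Set X // MeasurableSet S} := ⟨⟨∅, MeasurableSet.empty⟩⟩
  refine ciSup_le fun ⟨S, hS⟩ => ?_
  apply Real.le_sqrt_of_sq_le
  rw [sq_abs]
  have h := hellingerAffinity_le_sqrt_add_sqrt P Q hS
  have h' : (hellingerAffinity P Q).toReal ≤ √(P.real S) * √(Q.real S) +
      √(1 - P.real S) * √(1 - Q.real S) := by
    rw [← probReal_compl_eq_one_sub hS, ← probReal_compl_eq_one_sub hS]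
    have := ENNReal.toReal_mono (by finiteness) h
    rw [ENNReal.toReal_add (by finiteness) (by finiteness)] at this
    simpa [← ENNReal.toReal_rpow, Real.sqrt_eq_rpow, Measure.real] using this
  have hx0 : 0 ≤ P.real S := measureReal_nonneg
  have hy0 : 0 ≤ Q.real S := measureReal_nonneg
  have hx1 : 0 ≤ 1 - P.real S := by linarith [measureReal_le_one (μ := P) (s := S)]
  have hy1 : 0 ≤ 1 - Q.real S := by linarith [measureReal_le_one (μ := Q) (s := S)]
  have ha : 0 ≤ (hellingerAffinity P Q).toReal := ENNReal.toReal_nonneg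
  generalize (hellingerAffinity P Q).toReal = a at *
  have e1 := Real.sq_sqrt hx0
  have e2 := Real.sq_sqrt hy0
  have e3 := Real.sq_sqrt hx1
  have e4 := Real.sq_sqrt hy1
  generalize P.real S = x at *
  generalize Q.real S = y at *
  have hsq := pow_le_pow_left₀ ha h' 2
  -- With this AM-GM, the squared two-point affinity is at most `1 - (x - y) ^ 2`.
  have hab := two_mul_le_add_sq (√x * √(1 - x)) (√y * √(1 - y))
  have e : (√x * √y + √(1 - x) * √(1 - y)) ^ 2 = x * y + (1 - x) * (1 - y) +
      2 * (√x * √(1 - x)) * (√y * √(1 - y)) := by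
    linear_combination (√y ^ 2) * e1 + x * e2 + √(1 - y) ^ 2 * e3 + (1 - x) * e4
  have e' : (√x * √(1 - x)) ^ 2 + (√y * √(1 - y)) ^ 2 = x * (1 - x) + y * (1 - y) := by
    linear_combination √(1 - x) ^ 2 * e1 + x * e3 + √(1 - y) ^ 2 * e2 + y * e4
  nlinarith

end Affinity

/-! ### Products: densities and multiplicativity of the affinity. -/

section Product

lemma lintegral_pi_prod {n : ℕ} {Z : Fin n → Type*} [∀ i, MeasurableSpace (Z i)]
    (ν : ∀ i, Measure (Z i)) [∀ i, SigmaFinite (ν i)] {f : ∀ i, Z i → ℝ≥0∞}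
    (hf : ∀ i, Measurable (f i)) :
    ∫⁻ x, ∏ i, f i (x i) ∂(Measure.pi ν) = ∏ i, ∫⁻ x, f i x ∂(ν i) := by
  induction n with
  | zero => simp
  | succ n ih =>
    have := (measurePreserving_piFinSuccAbove ν 0).symm
    rw [← this.lintegral_comp_emb (MeasurableEquiv.measurableEmbedding _)]
    simp_rw [MeasurableEquiv.piFinSuccAbove_symm_apply, Fin.insertNthEquiv,
      Fin.prod_univ_succ, Fin.insertNth_zero]
    simp only [Fin.zero_succAbove]
    rw [← ih (fun i => ν i.succ) (fun i => hf i.succ)]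
    have hσ : SigmaFinite (Measure.pi fun i : Fin n => ν i.succ) := inferInstance
    refine @lintegral_prod_mul _ _ _ _ _ _ (@instSFiniteOfSigmaFinite _ _ _ hσ) (f 0)
      (fun y : ∀ i : Fin n, Z i.succ => ∏ i : Fin n, f i.succ (y i)) (hf 0).aemeasurable ?_
    refine (Finset.measurable_fun_prod _ fun i _ => ?_).aemeasurable
    exact (hf i.succ).comp (measurable_pi_apply i)

lemma pi_withDensity {n : ℕ} {Z : Fin n → Type*} [∀ i, MeasurableSpace (Z i)]
    (ν : ∀ i, Measure (Z i)) [∀ i, SigmaFinite (ν i)] (M : ∀ i, Measure (Z i))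
    [∀ i, SigmaFinite (M i)] {f : ∀ i, Z i → ℝ≥0∞}
    (hf : ∀ i, Measurable (f i)) (hM : ∀ i, (ν i).withDensity (f i) = M i) :
    (Measure.pi ν).withDensity (fun x => ∏ i, f i (x i)) = Measure.pi M := by
  symm
  refine Measure.pi_eq fun s hs => ?_
  rw [withDensity_apply _ (MeasurableSet.univ_pi hs), ← lintegral_indicator (MeasurableSet.univ_pi hs)]
  have : ∀ x : ∀ i, Z i, (Set.univ.pi s).indicator (fun x => ∏ i, f i (x i)) x =
      ∏ i, (s i).indicator (f i) (x i) := by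
    intro x
    by_cases hx : x ∈ Set.univ.pi s
    · rw [Set.indicator_of_mem hx]
      exact Finset.prod_congr rfl fun i _ => (Set.indicator_of_mem (hx i trivial) _).symm
    · rw [Set.indicator_of_notMem hx]
      obtain ⟨i, hi⟩ : ∃ i, x i ∉ s i := by simpa [Set.mem_pi] using hx
      exact (Finset.prod_eq_zero (Finset.mem_univ i) (Set.indicator_of_notMem hi _)).symm
  simp_rw [this]
  rw [lintegral_pi_prod ν fun i => (hf i).indicator (hs i)]
  refine Finset.prod_congr rfl fun i _ => ?_
  rw [lintegral_indicator (hs i), ← withDensity_apply _ (hs i), hM]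

/-- The Hellinger affinity is multiplicative over products. -/
lemma hellingerAffinity_pi {n : ℕ} {Z : Fin n → Type*} [∀ i, MeasurableSpace (Z i)]
    (P Q : ∀ i, Measure (Z i)) [∀ i, IsProbabilityMeasure (P i)]
    [∀ i, IsProbabilityMeasure (Q i)] :
    hellingerAffinity (Measure.pi P) (Measure.pi Q) = ∏ i, hellingerAffinity (P i) (Q i) := by
  choose p q hp hq _ _ hP hQ using fun i => exists_densities (P i) (Q i)
  have hm : ∀ r : ∀ i, Z i → ℝ≥0∞, (∀ i, Measurable (r i)) →
      Measurable fun x : ∀ i, Z i => ∏ i, r i (x i) := fun r hr =>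
    Finset.measurable_fun_prod _ fun i _ => (hr i).comp (measurable_pi_apply i)
  rw [hellingerAffinity_eq_of_withDensity _ _ (hm p hp) (hm q hq) (pi_withDensity _ _ hp hP)
    (pi_withDensity _ _ hq hQ)]
  simp_rw [hellingerAffinity_eq_of_withDensity _ _ (hp _) (hq _) (hP _) (hQ _)]
  rw [← lintegral_pi_prod (fun i => P i + Q i) (f := fun i x => (p i x * q i x) ^ (1 / 2 : ℝ))
    fun i => ((hp i).mul (hq i)).pow_const _]
  refine lintegral_congr fun x => ?_
  rw [← Finset.prod_mul_distrib, ENNReal.prod_rpow_of_nonneg (by norm_num)]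

end Product

/-! ### Indistinguishability: affinity bound and composition. -/

section Privacy

/-- Here `E = e^(ε/2)`, `a = √p`, `b = √q`. When the ratio of `a` and `b` lies in `[1/E, E]` the
claim is `(E b - a) (E a - b) ≥ 0`; beyond `E` or `1/E` the minima are proportional to the square of
the smaller number. -/
lemma add_inv_mul_mul_ge {E a b : ℝ} (hE : 1 ≤ E) (ha : 0 ≤ a) (hb : 0 ≤ b) :
    min (a ^ 2) (E ^ 2 * b ^ 2) + min (b ^ 2) (E ^ 2 * a ^ 2) ≤ (E + E⁻¹) * (a * b) := by
  have hE0 : 0 < E := by linarith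
  have hk : E * E⁻¹ = 1 := mul_inv_cancel₀ hE0.ne'
  have hi : 0 < E⁻¹ := inv_pos.2 hE0
  rcases le_total (E * b) a with h | h
  · have h1 := min_le_right (a ^ 2) (E ^ 2 * b ^ 2)
    have h2 := min_le_left (b ^ 2) (E ^ 2 * a ^ 2)
    have h3 : (E + E⁻¹) * (E * b * b) ≤ (E + E⁻¹) * (a * b) := by gcongr
    have h4 : (E + E⁻¹) * (E * b * b) = E ^ 2 * b ^ 2 + b ^ 2 := by
      linear_combination b ^ 2 * hk
    linarith
  · rcases le_total (E * a) b with h' | h'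
    · have h1 := min_le_left (a ^ 2) (E ^ 2 * b ^ 2)
      have h2 := min_le_right (b ^ 2) (E ^ 2 * a ^ 2)
      have h3 : (E + E⁻¹) * (a * (E * a)) ≤ (E + E⁻¹) * (a * b) := by gcongr
      have h4 : (E + E⁻¹) * (a * (E * a)) = E ^ 2 * a ^ 2 + a ^ 2 := by
        linear_combination a ^ 2 * hk
      linarith
    · have h1 := min_le_left (a ^ 2) (E ^ 2 * b ^ 2)
      have h2 := min_le_left (b ^ 2) (E ^ 2 * a ^ 2)
      have h3 : 0 ≤ E⁻¹ * ((E * b - a) * (E * a - b)) :=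
        mul_nonneg hi.le (mul_nonneg (sub_nonneg.2 h) (sub_nonneg.2 h'))
      have h4 : E⁻¹ * ((E * b - a) * (E * a - b)) = (E + E⁻¹) * (a * b) - a ^ 2 - b ^ 2 := by
        linear_combination (E * a * b - a ^ 2 - b ^ 2) * hk
      linarith

lemma min_add_min_le {ε : ℝ} (hε : 0 ≤ ε) {p q : ℝ≥0∞} (hp : p ≠ ∞) (hq : q ≠ ∞) :
    min p (ENNReal.ofReal (Real.exp ε) * q) + min q (ENNReal.ofReal (Real.exp ε) * p) ≤
      ENNReal.ofReal (Real.exp (ε / 2) + Real.exp (-(ε / 2))) * (p * q) ^ (1 / 2 : ℝ) := by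
  lift p to NNReal using hp
  lift q to NNReal using hq
  have h := add_inv_mul_mul_ge (Real.one_le_exp (by positivity : 0 ≤ ε / 2)) (Real.sqrt_nonneg p)
    (Real.sqrt_nonneg q)
  rw [Real.sq_sqrt p.coe_nonneg, Real.sq_sqrt q.coe_nonneg, ← Real.sqrt_mul p.coe_nonneg, ← Real.exp_neg, ← Real.exp_nat_mul,
    show ((2 : ℕ) : ℝ) * (ε / 2) = ε by push_cast; ring] at h
  rw [← ENNReal.ofReal_coe_nnreal, ← ENNReal.ofReal_coe_nnreal (p := q),
    ← ENNReal.ofReal_mul (by positivity), ← ENNReal.ofReal_mul (by positivity),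
    ← ENNReal.ofReal_mul (by positivity), ENNReal.ofReal_rpow_of_nonneg (by positivity) (by norm_num),
    ← ENNReal.ofReal_mul (by positivity), ← Real.sqrt_eq_rpow, ← ENNReal.ofReal_min,
    ← ENNReal.ofReal_min, ← ENNReal.ofReal_add (by positivity) (by positivity)]
  exact ENNReal.ofReal_le_ofReal h

variable {X : Type*} [MeasurableSpace X]

/-- The hypothesis is used only on the worst event `{c q ≤ p}`; off it the minimum is `p`. -/
lemma one_le_lintegral_min {ν P Q : Measure X} [IsProbabilityMeasure P] {p q : X → ℝ≥0∞}
    (hp : Measurable p) (hq : Measurable q) (hP : ν.withDensity p = P) (hQ : ν.withDensity q = Q)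
    {c t : ℝ≥0∞} (h : ∀ S, MeasurableSet S → P S ≤ c * Q S + t) :
    1 ≤ ∫⁻ x, min (p x) (c * q x) ∂ν + t := by
  have hS : MeasurableSet {x | c * q x ≤ p x} := measurableSet_le (hq.const_mul c) hp
  set S := {x | c * q x ≤ p x}
  have h1 : ∫⁻ x in S, min (p x) (c * q x) ∂ν = c * Q S := by
    rw [← hQ, withDensity_apply _ hS, ← lintegral_const_mul _ hq]
    exact setLIntegral_congr_fun hS fun x hx => min_eq_right hx
  have h2 : ∫⁻ x in Sᶜ, min (p x) (c * q x) ∂ν = P Sᶜ := by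
    rw [← hP, withDensity_apply _ hS.compl]
    exact setLIntegral_congr_fun hS.compl fun x hx => min_eq_left (le_of_not_ge fun h' => hx h')
  rw [← lintegral_add_compl _ hS, h1, h2]
  calc (1 : ℝ≥0∞) = P S + P Sᶜ := by rw [measure_add_measure_compl hS, measure_univ]
    _ ≤ c * Q S + t + P Sᶜ := by gcongr; exact h S hS
    _ = _ := by ring

lemma Indistinguishable.two_le {ε δ : ℝ} (hε : 0 ≤ ε) {P Q : Measure X} [IsProbabilityMeasure P]
    [IsProbabilityMeasure Q] (h : Indistinguishable ε δ P Q) :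
    2 ≤ ENNReal.ofReal (Real.exp (ε / 2) + Real.exp (-(ε / 2))) * hellingerAffinity P Q +
      2 * ENNReal.ofReal δ := by
  obtain ⟨p, q, hp, hq, hpt, hqt, hP, hQ⟩ := exists_densities P Q
  rw [hellingerAffinity_eq_of_withDensity P Q hp hq hP hQ]
  set ν := P + Q with hν
  have h1 := one_le_lintegral_min hp hq hP hQ fun S hS => (h S hS).1
  have h2 := one_le_lintegral_min hq hp hQ hP fun S hS => (h S hS).2
  calc (2 : ℝ≥0∞) = 1 + 1 := by norm_num
    _ ≤ _ := add_le_add h1 h2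
    _ = ∫⁻ x, (min (p x) (ENNReal.ofReal (Real.exp ε) * q x) +
          min (q x) (ENNReal.ofReal (Real.exp ε) * p x)) ∂ν + 2 * ENNReal.ofReal δ := by
        rw [lintegral_add_left (hp.min (hq.const_mul _))]
        ring
    _ ≤ _ := by
        rw [← lintegral_const_mul _ (by fun_prop)]
        gcongr with x
        exact min_add_min_le hε (hpt x) (hqt x)

lemma Indistinguishable.le_hellingerAffinity {ε δ : ℝ} (hε : 0 ≤ ε) (hδ : 0 ≤ δ)
    {P Q : Measure X} [IsProbabilityMeasure P] [IsProbabilityMeasure Q]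
    (h : Indistinguishable ε δ P Q) :
    2 * (1 - δ) / (Real.exp (ε / 2) + Real.exp (-(ε / 2))) ≤ (hellingerAffinity P Q).toReal := by
  have h2 := h.two_le hε
  have hfin : hellingerAffinity P Q ≠ ∞ :=
    ne_top_of_le_ne_top ENNReal.one_ne_top (hellingerAffinity_le_one P Q)
  have := ENNReal.toReal_mono (by finiteness) h2
  rw [ENNReal.toReal_add (by finiteness) (by finiteness), ENNReal.toReal_mul, ENNReal.toReal_mul,
    ENNReal.toReal_ofReal (by positivity), ENNReal.toReal_ofReal hδ] at this
  rw [div_le_iff₀ (by positivity)]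
  simp only [ENNReal.toReal_ofNat] at this
  linarith

/-- The two directions give `e^ε₁ δ₂ + δ₁` and `e^ε₂ δ₁ + δ₂`; the stated error dominates both. -/
lemma Indistinguishable.trans {ε₁ ε₂ δ₁ δ₂ : ℝ} (hε₁ : 0 ≤ ε₁) (hε₂ : 0 ≤ ε₂) (hδ₁ : 0 ≤ δ₁)
    (hδ₂ : 0 ≤ δ₂) {P Q R : Measure X} (h₁ : Indistinguishable ε₁ δ₁ P Q)
    (h₂ : Indistinguishable ε₂ δ₂ Q R) :
    Indistinguishable (ε₁ + ε₂) (Real.exp ε₁ * δ₂ + Real.exp ε₂ * δ₁) P R := by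
  intro S hS
  rw [ENNReal.ofReal_add (by positivity) (by positivity), Real.exp_add,
    ENNReal.ofReal_mul (by positivity), ENNReal.ofReal_mul (by positivity),
    ENNReal.ofReal_mul (by positivity)]
  have e₁ : 1 ≤ ENNReal.ofReal (Real.exp ε₁) := ENNReal.one_le_ofReal.2 (Real.one_le_exp hε₁)
  have e₂ : 1 ≤ ENNReal.ofReal (Real.exp ε₂) := ENNReal.one_le_ofReal.2 (Real.one_le_exp hε₂)
  obtain ⟨a, b⟩ := h₁ S hS
  obtain ⟨c, d⟩ := h₂ S hS
  generalize ENNReal.ofReal (Real.exp ε₁) = x at *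
  generalize ENNReal.ofReal (Real.exp ε₂) = y at *
  generalize ENNReal.ofReal δ₁ = s at *
  generalize ENNReal.ofReal δ₂ = t at *
  constructor
  · calc P S ≤ x * (y * R S + t) + 1 * s := by
          rw [one_mul]; exact a.trans (by gcongr)
      _ ≤ x * (y * R S + t) + y * s := by gcongr
      _ = _ := by ring
  · calc R S ≤ y * (x * P S + s) + 1 * t := by
          rw [one_mul]; exact d.trans (by gcongr)
      _ ≤ y * (x * P S + s) + x * t := by gcongr
      _ = _ := by ring

lemma Indistinguishable.mono {ε δ δ' : ℝ} (hδ : δ ≤ δ') {P Q : Measure X}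
    (h : Indistinguishable ε δ P Q) : Indistinguishable ε δ' P Q := fun S hS =>
  ⟨(h S hS).1.trans (by gcongr), (h S hS).2.trans (by gcongr)⟩

end Privacy

/-! ### Group privacy for complete bipartite graphs. -/

section Reports

variable {n : ℕ} {Ω : Type*} [MeasurableSpace Ω] {Z : Fin n → Type*}
    [∀ i, MeasurableSpace (Z i)] (R : ∀ i, Set (Fin n) → Kernel Ω (Z i))

/-- Group privacy along the stars of the nodes in `T`. -/
lemma indistinguishable_between {ε δ : ℝ} (hε : 0 ≤ ε) (hδ : 0 ≤ δ) (ρ : Ω)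
    (h : ∀ G G' : SimpleGraph (Fin n), NodeNeighbors G G' →
      Indistinguishable ε δ (reports R ρ G) (reports R ρ G')) (U : Set (Fin n))
    (T : Finset (Fin n)) :
    Indistinguishable (T.card * ε) (T.card * δ * Real.exp (T.card * ε))
      (reports R ρ ((⊤ : SimpleGraph (Fin n)).between T U)) (reports R ρ ⊥) := by
  induction T using Finset.induction_on with
  | empty =>
    have : (⊤ : SimpleGraph (Fin n)).between ((∅ : Finset (Fin n)) : Set (Fin n)) U = ⊥ := by
      ext j k
      simp [SimpleGraph.between_adj]
    rw [this]
    intro S _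
    simp
  | insert a T ha ih =>
    have hn : NodeNeighbors ((⊤ : SimpleGraph (Fin n)).between (insert a T : Finset (Fin n)) U)
        ((⊤ : SimpleGraph (Fin n)).between T U) := by
      refine ⟨a, fun j k hj hk => ?_⟩
      simp [SimpleGraph.between_adj, hj, hk]
    have := (h _ _ hn).trans hε (by positivity) hδ (by positivity) ih
    rw [Finset.card_insert_of_notMem ha]
    push_cast
    rw [add_mul, one_mul, add_comm (_ * ε) ε]
    have hk : ((insert a T : Finset (Fin n)) : Set (Fin n)) = insert a (T : Set (Fin n)) := by simp
    rw [hk] at this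
    refine this.mono ?_
    -- With `k = T.card`, the new error `e^ε (k δ e^(kε)) + e^(kε) δ` must fit under `(k + 1) δ
    -- e^((k+1)ε)`.
    have he : Real.exp (T.card * ε) * δ ≤ Real.exp (ε + T.card * ε) * δ := by
      gcongr
      linarith
    rw [Real.exp_add] at he ⊢
    linarith

variable [∀ i N, IsMarkovKernel (R i N)]

instance isProbabilityMeasure_reports (ρ : Ω) (G : SimpleGraph (Fin n)) :
    IsProbabilityMeasure (reports R ρ G) := by
  unfold reports
  infer_instance

lemma measurable_reports (G : SimpleGraph (Fin n)) : Measurable fun ρ => reports R ρ G := by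
  refine Measurable.measure_of_isPiSystem_of_isProbabilityMeasure generateFrom_pi.symm
    isPiSystem_pi ?_
  rintro _ ⟨s, hs, rfl⟩
  simp only [reports, Measure.pi_pi]
  exact Finset.measurable_fun_prod _ fun i _ =>
    Kernel.measurable_coe _ (hs i trivial)

lemma hellingerAffinity_reports (ρ : Ω) (G G' : SimpleGraph (Fin n)) :
    hellingerAffinity (reports R ρ G) (reports R ρ G') =
      ∏ i, hellingerAffinity (R i (G.neighborSet i) ρ) (R i (G'.neighborSet i) ρ) :=
  hellingerAffinity_pi _ _

/-- The nodes outside `S`, when all of them have neighborhood `S`, jointly reveal little. -/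
lemma le_prod_hellingerAffinity {ε δ : ℝ} (hε : 0 ≤ ε) (hδ : 0 ≤ δ) (ρ : Ω)
    (h : ∀ G G' : SimpleGraph (Fin n), NodeNeighbors G G' →
      Indistinguishable ε δ (reports R ρ G) (reports R ρ G')) (S : Finset (Fin n)) :
    2 * (1 - S.card * δ * Real.exp (S.card * ε)) /
        (Real.exp (S.card * ε / 2) + Real.exp (-(S.card * ε / 2))) ≤
      ∏ i ∈ Sᶜ, (hellingerAffinity (R i S ρ) (R i ∅ ρ)).toReal := by
  refine ((indistinguishable_between R hε hδ ρ h (S : Set (Fin n))ᶜ S).le_hellingerAffinity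
    (by positivity) (by positivity)).trans ?_
  rw [hellingerAffinity_reports, ENNReal.toReal_prod, ← Finset.prod_compl_mul_prod S]
  have h1 : ∀ G G' : SimpleGraph (Fin n), ∀ i,
      (hellingerAffinity (R i (G.neighborSet i) ρ) (R i (G'.neighborSet i) ρ)).toReal ≤ 1 :=
    fun G G' i => ENNReal.toReal_le_of_le_ofReal zero_le_one
      (by simpa using hellingerAffinity_le_one _ _)
  -- The factors of the nodes in `S` are at most one and are dropped.
  refine (mul_le_of_le_one_right (Finset.prod_nonneg fun _ _ => ENNReal.toReal_nonneg)
    (Finset.prod_le_one (fun _ _ => ENNReal.toReal_nonneg) fun i _ => h1 _ _ i)).trans_eq ?_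
  refine Finset.prod_congr rfl fun i hi => ?_
  have hi' : i ∉ S := by simpa using hi
  have e1 : ((⊤ : SimpleGraph (Fin n)).between S (S : Set (Fin n))ᶜ).neighborSet i = S := by
    ext j
    simp only [SimpleGraph.mem_neighborSet, SimpleGraph.between_adj]
    simp [hi']
    rintro hj rfl
    exact hi' hj
  have e2 : (⊥ : SimpleGraph (Fin n)).neighborSet i = ∅ := by
    ext j
    simp
  rw [e1, e2]

end Reports

/-! ### Averaging node costs over relabelings. -/

section Symmetrization

open Finset

variable {n : ℕ}

/-- The symmetric group is transitive on pairs of a set of given size and a point outside it; right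
translation by a permutation `τ` carrying one pair to the other matches the sums. In the proof,
`none` stands for the extra point. -/
lemma sum_perm_eq (c : Fin n → Finset (Fin n) → ℝ) {N N' : Finset (Fin n)} {j j' : Fin n}
    (hN : N.card = N'.card) (hj : j ∉ N) (hj' : j' ∉ N') :
    ∑ σ : Equiv.Perm (Fin n), c (σ j) (N.map σ.toEmbedding) =
      ∑ σ : Equiv.Perm (Fin n), c (σ j') (N'.map σ.toEmbedding) := by
  let e := Finset.equivOfCardEq hN
  obtain ⟨τ, hτ⟩ := Equiv.Perm.exists_extending_pair
    (fun o : Option N => o.elim j fun x => (x : Fin n))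
    (fun o : Option N => o.elim j' fun x => (e x : Fin n))
    (by
      rintro (_ | a) (_ | b) h
      · rfl
      · exact absurd (show j ∈ N from (show j = b from h) ▸ b.2) hj
      · exact absurd (show j ∈ N from (show (a : Fin n) = j from h) ▸ a.2) hj
      · exact congrArg some (Subtype.ext h))
    (by
      rintro (_ | a) (_ | b) h
      · rfl
      · exact absurd (show j' ∈ N' from (show j' = e b from h) ▸ (e b).2) hj'
      · exact absurd (show j' ∈ N' from (show (e a : Fin n) = j' from h) ▸ (e a).2) hj'
      · exact congrArg some (e.injective (Subtype.ext h)))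
  have h1 : τ j = j' := hτ none
  have h2 : N.map τ.toEmbedding = N' := by
    refine Finset.eq_of_subset_of_card_le (fun y hy => ?_) (by rw [Finset.card_map, hN])
    obtain ⟨x, hx, rfl⟩ := Finset.mem_map.1 hy
    have : τ x = e ⟨x, hx⟩ := hτ (some ⟨x, hx⟩)
    exact this ▸ (e ⟨x, hx⟩).2
  refine (Fintype.sum_equiv (Equiv.mulRight τ) _ _ fun σ => ?_).symm
  simp only [Equiv.coe_mulRight, Equiv.Perm.mul_apply, h1]
  rw [← h2, Finset.map_map]
  rfl

/-- Averaging over relabelings: a bound on the costs of the nodes outside any `d`-set bounds the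
cost of a fixed node and neighborhood. -/
lemma sub_mul_sum_perm_le (c : Fin n → Finset (Fin n) → ℝ) {d : ℕ} {L : ℝ}
    (hc : ∀ S : Finset (Fin n), S.card = d → ∑ i ∈ Sᶜ, c i S ≤ L) {N : Finset (Fin n)} {j : Fin n}
    (hN : N.card = d) (hj : j ∉ N) :
    ((n : ℝ) - d) * ∑ σ : Equiv.Perm (Fin n), c (σ j) (N.map σ.toEmbedding) ≤
      Fintype.card (Equiv.Perm (Fin n)) * L := by
  have hcard : ((Nᶜ.card : ℕ) : ℝ) = (n : ℝ) - d := by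
    rw [Finset.card_compl, hN, Fintype.card_fin, Nat.cast_sub]
    rw [← hN]
    simpa using Finset.card_le_univ N
  calc ((n : ℝ) - d) * ∑ σ : Equiv.Perm (Fin n), c (σ j) (N.map σ.toEmbedding)
      = ∑ i ∈ Nᶜ, ∑ σ : Equiv.Perm (Fin n), c (σ i) (N.map σ.toEmbedding) := by
        -- All `n - d` points outside `N` give the same sum as `j`.
        rw [Finset.sum_congr rfl fun i hi => sum_perm_eq c (N' := N) (j' := j) rfl
          (by simpa using hi) hj, Finset.sum_const, nsmul_eq_mul, hcard]
    _ = ∑ σ : Equiv.Perm (Fin n), ∑ i ∈ Nᶜ, c (σ i) (N.map σ.toEmbedding) := Finset.sum_comm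
    _ = ∑ σ : Equiv.Perm (Fin n), ∑ i ∈ (N.map σ.toEmbedding)ᶜ, c i (N.map σ.toEmbedding) := by
        refine Finset.sum_congr rfl fun σ _ => ?_
        refine Finset.sum_equiv σ (fun i => ?_) fun i _ => rfl
        simp
    _ ≤ ∑ _σ : Equiv.Perm (Fin n), L :=
        Finset.sum_le_sum fun σ _ => hc _ (by rw [Finset.card_map, hN])
    _ = _ := by simp

open Classical in
/-- Total cost of the neighborhoods of all nodes, averaged over `d`-regular graphs. -/
lemma sum_regular_le (c : Fin n → Finset (Fin n) → ℝ) {d : ℕ} {L : ℝ}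
    (hc : ∀ S : Finset (Fin n), S.card = d → ∑ i ∈ Sᶜ, c i S ≤ L) :
    ((n : ℝ) - d) * ∑ G : SimpleGraph (Fin n) with G.IsRegularOfDegree d,
        ∑ i, c i (G.neighborFinset i) ≤
      #{G : SimpleGraph (Fin n) | G.IsRegularOfDegree d} * (n * L) := by
  set 𝒢 : Finset (SimpleGraph (Fin n)) := {G | G.IsRegularOfDegree d} with h𝒢
  -- Relabeling by `σ` permutes the set of `d`-regular graphs.
  have hrel : ∀ σ : Equiv.Perm (Fin n), ∑ G ∈ 𝒢, ∑ i, c i (G.neighborFinset i) =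
      ∑ G ∈ 𝒢, ∑ j, c (σ j) ((G.neighborFinset j).map σ.toEmbedding) := by
    intro σ
    have hnb : ∀ (G H : SimpleGraph (Fin n)) j, σ.simpleGraph G = H → H.neighborFinset (σ j) =
        (G.neighborFinset j).map σ.toEmbedding := by
      rintro G _ j rfl
      ext k
      simp [SimpleGraph.comap_adj]
    symm
    refine Finset.sum_equiv σ.simpleGraph (fun G => ?_) fun G _ => ?_
    · rw [h𝒢, Finset.mem_filter, Finset.mem_filter]
      simp only [Finset.mem_univ, true_and, SimpleGraph.IsRegularOfDegree]
      rw [← σ.forall_congr_right (q := fun v => (σ.simpleGraph G).degree v = d)]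
      refine forall_congr' fun v => ?_
      rw [← SimpleGraph.card_neighborFinset_eq_degree, ← SimpleGraph.card_neighborFinset_eq_degree,
        hnb G (σ.simpleGraph G) v rfl, Finset.card_map]
    · exact Finset.sum_equiv σ (by simp) fun j _ => by rw [hnb G (σ.simpleGraph G) j rfl]
  have hpos : (0 : ℝ) < Fintype.card (Equiv.Perm (Fin n)) := by exact_mod_cast Fintype.card_pos
  refine le_of_mul_le_mul_left ?_ hpos
  calc (Fintype.card (Equiv.Perm (Fin n)) : ℝ) *
        (((n : ℝ) - d) * ∑ G ∈ 𝒢, ∑ i, c i (G.neighborFinset i))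
      = ((n : ℝ) - d) * ∑ _σ : Equiv.Perm (Fin n), ∑ G ∈ 𝒢, ∑ i, c i (G.neighborFinset i) := by
        rw [Finset.sum_const, nsmul_eq_mul, Finset.card_univ]
        ring
    _ = ((n : ℝ) - d) * ∑ G ∈ 𝒢, ∑ j, ∑ σ : Equiv.Perm (Fin n),
          c (σ j) ((G.neighborFinset j).map σ.toEmbedding) := by
        rw [Finset.sum_congr rfl fun σ _ => hrel σ, Finset.sum_comm]
        simp_rw [Finset.sum_comm (s := (Finset.univ : Finset (Equiv.Perm (Fin n))))]
    _ = ∑ G ∈ 𝒢, ∑ j, ((n : ℝ) - d) * ∑ σ : Equiv.Perm (Fin n),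
          c (σ j) ((G.neighborFinset j).map σ.toEmbedding) := by
        simp_rw [Finset.mul_sum]
    _ ≤ ∑ G ∈ 𝒢, ∑ _j : Fin n, Fintype.card (Equiv.Perm (Fin n)) * L := by
        refine Finset.sum_le_sum fun G hG => Finset.sum_le_sum fun j _ => ?_
        refine sub_mul_sum_perm_le c hc ?_ (by simp)
        rw [SimpleGraph.card_neighborFinset_eq_degree]
        exact (Finset.mem_filter.1 hG).2 j
    _ = _ := by
        simp only [Finset.sum_const, nsmul_eq_mul, Finset.card_univ, Fintype.card_fin]
        ring

end Symmetrization

/-! ### Mean affinity for fixed public randomness. -/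

section Mean

variable {n : ℕ} {Ω : Type*} [MeasurableSpace Ω] {Z : Fin n → Type*}
    [∀ i, MeasurableSpace (Z i)] (R : ∀ i, Set (Fin n) → Kernel Ω (Z i))
    [∀ i N, IsMarkovKernel (R i N)]

open Finset in
/-- Jensen's inequality for `exp (-x)`. -/
lemma exp_neg_mul_card_le {ι : Type*} (s : Finset ι) (x : ι → ℝ) {m : ℝ}
    (h : ∑ i ∈ s, x i ≤ #s * m) : Real.exp (-m) * #s ≤ ∑ i ∈ s, Real.exp (-x i) := by
  -- Tangent line of `exp (-x)` at `m`.
  have h1 : ∀ i ∈ s, Real.exp (-m) * (m - x i + 1) ≤ Real.exp (-x i) := fun i _ => by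
    calc Real.exp (-m) * (m - x i + 1) ≤ Real.exp (-m) * Real.exp (m - x i) := by
          gcongr; exact Real.add_one_le_exp _
      _ = _ := by rw [← Real.exp_add]; congr 1; ring
  refine le_trans ?_ (Finset.sum_le_sum h1)
  rw [← Finset.mul_sum, Finset.sum_add_distrib, Finset.sum_sub_distrib]
  gcongr
  simp only [Finset.sum_const, nsmul_eq_mul, mul_one]
  linarith

open Classical Finset in
/-- For fixed public randomness, the mean over `d`-regular graphs of the affinity between the
reports on the graph and the reports on the empty graph. -/
lemma exp_neg_mul_card_le_sum_hellingerAffinity {ε δ : ℝ} (hε : 0 ≤ ε) (hδ : 0 ≤ δ) {d : ℕ}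
    (hd : d < n) (hδ1 : d * δ * Real.exp (d * ε) < 1) (ρ : Ω)
    (h : ∀ G G' : SimpleGraph (Fin n), NodeNeighbors G G' →
      Indistinguishable ε δ (reports R ρ G) (reports R ρ G')) :
    Real.exp (-(Real.log ((Real.exp (d * ε / 2) + Real.exp (-(d * ε / 2))) /
        (2 * (1 - d * δ * Real.exp (d * ε)))) * (1 / (1 - (d : ℝ) / (n : ℝ))))) *
        #{G : SimpleGraph (Fin n) | G.IsRegularOfDegree d} ≤
      ∑ G : SimpleGraph (Fin n) with G.IsRegularOfDegree d,
        (hellingerAffinity (reports R ρ G) (reports R ρ ⊥)).toReal := by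
  set b : ℝ := (Real.exp (d * ε / 2) + Real.exp (-(d * ε / 2))) /
    (2 * (1 - d * δ * Real.exp (d * ε))) with hb
  have hδ2 : 0 < 1 - d * δ * Real.exp (d * ε) := by linarith
  have hb0 : 0 < b := by positivity
  let a : Fin n → Finset (Fin n) → ℝ := fun i S =>
    (hellingerAffinity (R i (S : Set (Fin n)) ρ) (R i ∅ ρ)).toReal
  have hprod : ∀ S : Finset (Fin n), S.card = d → b⁻¹ ≤ ∏ i ∈ Sᶜ, a i S := by
    intro S hS
    have := le_prod_hellingerAffinity R hε hδ ρ h S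
    rwa [hS, ← inv_div, ← hb] at this
  -- Nonvanishing matters: since `Real.log 0 = 0`, mutually singular reports would otherwise be
  -- assigned cost zero.
  have hne : ∀ S : Finset (Fin n), S.card = d → ∀ i ∈ Sᶜ, a i S ≠ 0 := fun S hS =>
    Finset.prod_ne_zero_iff.1 ((inv_pos.2 hb0).trans_le (hprod S hS)).ne'
  have hc : ∀ S : Finset (Fin n), S.card = d → ∑ i ∈ Sᶜ, -Real.log (a i S) ≤ Real.log b := by
    intro S hS
    rw [Finset.sum_neg_distrib, ← Real.log_prod (hne S hS), neg_le, ← Real.log_inv]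
    exact Real.log_le_log (inv_pos.2 hb0) (hprod S hS)
  have hsum := sum_regular_le (fun i S => -Real.log (a i S)) hc
  have hnd : (0 : ℝ) < n - d := sub_pos.2 (by exact_mod_cast hd)
  have hn : (n : ℝ) ≠ 0 := by
    have : 0 < n := by omega
    positivity
  have hJ := exp_neg_mul_card_le
    ({G : SimpleGraph (Fin n) | G.IsRegularOfDegree d} : Finset (SimpleGraph (Fin n)))
    (fun G => ∑ i, -Real.log (a i (G.neighborFinset i)))
    (m := Real.log b * (1 / (1 - (d : ℝ) / (n : ℝ)))) (by
      refine le_of_mul_le_mul_left (hsum.trans_eq ?_) hnd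
      have : (1 : ℝ) - d / n ≠ 0 := by
        rw [one_sub_div hn]
        positivity
      field_simp)
  refine hJ.trans_eq (Finset.sum_congr rfl fun G hG => ?_)
  have hG' : G.IsRegularOfDegree d := (Finset.mem_filter.1 hG).2
  rw [hellingerAffinity_reports, ENNReal.toReal_prod, Finset.sum_neg_distrib, neg_neg,
    Real.exp_sum]
  refine Finset.prod_congr rfl fun i _ => ?_
  have hcard : (G.neighborFinset i).card = d := by
    rw [SimpleGraph.card_neighborFinset_eq_degree]
    exact hG' i
  have hpos : 0 < a i (G.neighborFinset i) :=
    lt_of_le_of_ne ENNReal.toReal_nonneg (hne _ hcard i (by simp)).symm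
  rw [Real.exp_log hpos]
  have e : (⊥ : SimpleGraph (Fin n)).neighborSet i = ∅ := by
    ext j
    simp
  simp only [a, e, SimpleGraph.coe_neighborFinset]

end Mean

/-! ### The uniform law on regular graphs. -/

section Graphs

variable {n d : ℕ}

instance : MeasurableSingletonClass (SimpleGraph (Fin n)) where
  measurableSet_singleton G := by
    have : ({G} : Set (SimpleGraph (Fin n))) = SimpleGraph.Adj ⁻¹' {G.Adj} := by
      ext H
      exact SimpleGraph.adj_inj.symm
    rw [this]
    exact SimpleGraph.measurable_adj (measurableSet_singleton _)

open Classical in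
lemma isProbabilityMeasure_regularGraphLaw
    (h : ∃ G : SimpleGraph (Fin n), G.IsRegularOfDegree d) :
    IsProbabilityMeasure (regularGraphLaw n d) :=
  isProbabilityMeasure_uniformOn (Set.toFinite _) h

open Classical Finset in
lemma lintegral_regularGraphLaw (f : SimpleGraph (Fin n) → ℝ≥0∞) :
    ∫⁻ G, f G ∂(regularGraphLaw n d) =
      (#{G : SimpleGraph (Fin n) | G.IsRegularOfDegree d} : ℝ≥0∞)⁻¹ *
        ∑ G : SimpleGraph (Fin n) with G.IsRegularOfDegree d, f G := by
  have hcoe : {G : SimpleGraph (Fin n) | G.IsRegularOfDegree d} =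
      (({G : SimpleGraph (Fin n) | G.IsRegularOfDegree d} : Finset (SimpleGraph (Fin n))) :
        Set (SimpleGraph (Fin n))) := by simp
  unfold regularGraphLaw uniformOn ProbabilityTheory.cond
  rw [hcoe, lintegral_smul_measure, Measure.count_apply_finset, lintegral_finset,
    smul_eq_mul]
  simp

end Graphs

/-! ### Public randomness and postprocessing. -/

section Mixture

/-- Cauchy–Schwarz: the variational constraint survives averaging, so test functions on outputs pull
back to test functions on reports. -/
lemma one_le_lintegral_mul_lintegral {X : Type*} [MeasurableSpace X] (M : Measure X)
    [IsProbabilityMeasure M] {f g : X → ℝ≥0∞} (hf : Measurable f) (hg : Measurable g)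
    (hfg : ∀ x, 1 ≤ f x * g x) : 1 ≤ (∫⁻ x, f x ∂M) * ∫⁻ x, g x ∂M := by
  by_contra! hlt
  have h1 : (1 : ℝ≥0∞) ≤ ∫⁻ x, (f x * g x) ^ (1 / 2 : ℝ) ∂M := by
    calc (1 : ℝ≥0∞) = ∫⁻ _, 1 ∂M := by simp
      _ ≤ _ := lintegral_mono fun x => ENNReal.one_le_rpow (hfg x) (by norm_num)
  have h2 := lintegral_sqrt_mul_le M hf.aemeasurable hg.aemeasurable
  rw [← ENNReal.mul_rpow_of_nonneg _ _ (by norm_num : (0 : ℝ) ≤ 1 / 2)] at h2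
  exact absurd (h1.trans h2) (not_le.2 (ENNReal.rpow_lt_one hlt (by norm_num)))

/-- A Markov kernel does not decrease the Hellinger affinity (in variational form). -/
lemma two_mul_hellingerAffinity_le_lintegral_kernel {X Y : Type*} [MeasurableSpace X]
    [MeasurableSpace Y] (M N : Measure X) [IsFiniteMeasure M] [IsFiniteMeasure N] (K : Kernel X Y)
    [IsMarkovKernel K] {F H : Y → ℝ≥0∞} (hF : Measurable F) (hH : Measurable H)
    (hFH : ∀ y, 1 ≤ F y * H y) :
    2 * hellingerAffinity M N ≤ ∫⁻ x, ∫⁻ y, F y ∂(K x) ∂M + ∫⁻ x, ∫⁻ y, H y ∂(K x) ∂N :=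
  two_mul_hellingerAffinity_le M N hF.lintegral_kernel hH.lintegral_kernel fun x =>
    one_le_lintegral_mul_lintegral (K x) hF hH hFH

variable {n d : ℕ} {Y : Type w} [MeasurableSpace Y]

-- Nearly optimal test functions for the pair laws are sliced at each `G` and pulled back through
-- `P`. For every `ρ` they bound the affinities of the reports from above, while privacy bounds the
-- sum of these over `G` from below.
open Classical in
lemma ofReal_exp_neg_le_hellingerAffinity (hd : d < n)
    (hG : ∃ G : SimpleGraph (Fin n), G.IsRegularOfDegree d) {ε δ : ℝ} (hε : 0 ≤ ε) (hδ : 0 ≤ δ)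
    (hδ1 : d * δ * Real.exp (d * ε) < 1) (A : Kernel (SimpleGraph (Fin n)) Y) [IsMarkovKernel A]
    (hA : IsLNDP.{u, v, w} ε δ A) :
    ENNReal.ofReal (Real.exp (-(Real.log ((Real.exp (d * ε / 2) + Real.exp (-(d * ε / 2))) /
        (2 * (1 - d * δ * Real.exp (d * ε)))) * (1 / (1 - (d : ℝ) / (n : ℝ)))))) ≤
      hellingerAffinity (pairLaw d A) (pairLawEmpty d A) := by
  obtain ⟨Ω, _, μ, Z, _, R, P, hμ, hR, hP, hAP, hpriv⟩ := hA
  set β := Real.log ((Real.exp (d * ε / 2) + Real.exp (-(d * ε / 2))) /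
        (2 * (1 - d * δ * Real.exp (d * ε)))) * (1 / (1 - (d : ℝ) / (n : ℝ))) with hβ
  have := isProbabilityMeasure_regularGraphLaw hG
  have : IsProbabilityMeasure (pairLaw d A) := by unfold pairLaw; infer_instance
  have : IsProbabilityMeasure (pairLawEmpty d A) := by unfold pairLawEmpty; infer_instance
  have hmeas : ∀ G, Measurable fun ρ => (reports R ρ G).bind P := fun G =>
    (Measure.measurable_bind' P.measurable).comp (measurable_reports R G)
  have hAbind : ∀ G, A G = μ.bind fun ρ => (reports R ρ G).bind P := by
    intro G
    ext S hS
    rw [hAP G S hS, Measure.bind_apply hS (hmeas G).aemeasurable]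
    exact lintegral_congr fun ρ => (Measure.bind_apply hS P.aemeasurable).symm
  have hAint : ∀ G (f : Y → ℝ≥0∞), Measurable f →
      ∫⁻ y, f y ∂(A G) = ∫⁻ ρ, ∫⁻ z, ∫⁻ y, f y ∂(P z) ∂(reports R ρ G) ∂μ := by
    intro G f hf
    rw [hAbind, Measure.lintegral_bind (hmeas G).aemeasurable hf.aemeasurable]
    exact lintegral_congr fun ρ => Measure.lintegral_bind P.aemeasurable hf.aemeasurable
  have hmeas2 : ∀ G (f : Y → ℝ≥0∞), Measurable f →
      Measurable fun ρ => ∫⁻ z, ∫⁻ y, f y ∂(P z) ∂(reports R ρ G) := fun G f hf =>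
    (Measure.measurable_lintegral hf.lintegral_kernel).comp (measurable_reports R G)
  set 𝒢 : Finset (SimpleGraph (Fin n)) := {G | G.IsRegularOfDegree d} with h𝒢
  have h𝒢0 : (𝒢.card : ℝ≥0∞) ≠ 0 := by
    obtain ⟨G, hG⟩ := hG
    have hmem : G ∈ 𝒢 := by
      rw [h𝒢, Finset.mem_filter]
      exact ⟨Finset.mem_univ G, hG⟩
    exact Nat.cast_ne_zero.2 (Finset.card_ne_zero_of_mem hmem)
  -- The slack `κ` is there because test functions are only supplied up to an arbitrarily small
  -- error.
  have key : ∀ κ : NNReal, 0 < κ →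
      2 * ENNReal.ofReal (Real.exp (-β)) ≤
        2 * hellingerAffinity (pairLaw d A) (pairLawEmpty d A) + κ := by
    intro κ hκ
    obtain ⟨F, H, hF, hH, hFH, hle⟩ := exists_near_optimal (pairLaw d A) (pairLawEmpty d A)
      (κ := κ) (by simpa using hκ.ne')
    refine le_trans ?_ hle
    have hFG : ∀ G, Measurable fun y => F (G, y) := fun G => hF.comp measurable_prodMk_left
    have hHG : ∀ G, Measurable fun y => H (G, y) := fun G => hH.comp measurable_prodMk_left
    rw [pairLaw, pairLawEmpty, Measure.lintegral_compProd hF, lintegral_prod _ hH.aemeasurable,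
      lintegral_regularGraphLaw, lintegral_regularGraphLaw, ← mul_add, ← Finset.sum_add_distrib,
      ← h𝒢]
    have hsum : ∑ G ∈ 𝒢, (∫⁻ y, F (G, y) ∂(A G) + ∫⁻ y, H (G, y) ∂(A ⊥)) =
        ∫⁻ ρ, ∑ G ∈ 𝒢, (∫⁻ z, ∫⁻ y, F (G, y) ∂(P z) ∂(reports R ρ G) +
          ∫⁻ z, ∫⁻ y, H (G, y) ∂(P z) ∂(reports R ρ ⊥)) ∂μ := by
      have hm : ∀ G, Measurable fun ρ => ∫⁻ z, ∫⁻ y, F (G, y) ∂(P z) ∂(reports R ρ G) +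
          ∫⁻ z, ∫⁻ y, H (G, y) ∂(P z) ∂(reports R ρ ⊥) := fun G =>
        (hmeas2 G _ (hFG G)).add (hmeas2 ⊥ _ (hHG G))
      rw [lintegral_finsetSum _ fun G _ => hm G]
      refine Finset.sum_congr rfl fun G _ => ?_
      rw [lintegral_add_left (hmeas2 G _ (hFG G)), hAint G _ (hFG G), hAint ⊥ _ (hHG G)]
    have hlow : (𝒢.card : ℝ≥0∞) * (2 * ENNReal.ofReal (Real.exp (-β))) ≤
        ∑ G ∈ 𝒢, (∫⁻ y, F (G, y) ∂(A G) + ∫⁻ y, H (G, y) ∂(A ⊥)) := by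
      rw [hsum]
      calc (𝒢.card : ℝ≥0∞) * (2 * ENNReal.ofReal (Real.exp (-β)))
          = ∫⁻ _, (𝒢.card : ℝ≥0∞) * (2 * ENNReal.ofReal (Real.exp (-β))) ∂μ := by simp
        _ ≤ _ := lintegral_mono fun ρ => ?_
      have hρ := exp_neg_mul_card_le_sum_hellingerAffinity R hε hδ hd hδ1 ρ
        (fun G G' hGG' => hpriv G G' hGG' ρ)
      rw [← hβ, ← h𝒢] at hρ
      calc (𝒢.card : ℝ≥0∞) * (2 * ENNReal.ofReal (Real.exp (-β)))
          = 2 * ENNReal.ofReal (Real.exp (-β) * 𝒢.card) := by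
            rw [ENNReal.ofReal_mul (by positivity), ENNReal.ofReal_natCast]
            ring
        _ ≤ 2 * ENNReal.ofReal (∑ G ∈ 𝒢,
              (hellingerAffinity (reports R ρ G) (reports R ρ ⊥)).toReal) := by gcongr
        _ = ∑ G ∈ 𝒢, 2 * hellingerAffinity (reports R ρ G) (reports R ρ ⊥) := by
            rw [ENNReal.ofReal_sum_of_nonneg fun _ _ => ENNReal.toReal_nonneg, Finset.mul_sum]
            refine Finset.sum_congr rfl fun G _ => ?_
            rw [ENNReal.ofReal_toReal
              (ne_top_of_le_ne_top ENNReal.one_ne_top (hellingerAffinity_le_one _ _))]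
        _ ≤ _ := Finset.sum_le_sum fun G _ =>
            two_mul_hellingerAffinity_le_lintegral_kernel _ _ P (hFG G) (hHG G)
              fun y => hFH (G, y)
    calc 2 * ENNReal.ofReal (Real.exp (-β))
        = (𝒢.card : ℝ≥0∞)⁻¹ * (𝒢.card * (2 * ENNReal.ofReal (Real.exp (-β)))) := by
          rw [← mul_assoc, ENNReal.inv_mul_cancel h𝒢0 (by simp), one_mul]
      _ ≤ _ := by gcongr
  have := ENNReal.le_of_forall_pos_le_add fun κ hκ _ => key κ hκ
  exact (ENNReal.mul_le_mul_iff_right (by norm_num) (by norm_num)).1 this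

lemma bhattDist_le_of_ofReal_exp_neg_le {X : Type*} [MeasurableSpace X] {P Q : Measure X} {β : ℝ}
    (h : ENNReal.ofReal (Real.exp (-β)) ≤ hellingerAffinity P Q) :
    bhattDist P Q ≤ (β : EReal) := by
  have h1 := ENNReal.log_le_log h
  rw [ENNReal.log_ofReal_of_pos (Real.exp_pos _), Real.log_exp] at h1
  unfold bhattDist
  rw [EReal.neg_le]
  simpa using h1

/-- The squared distance is at most `1 - e^(-2β) ≤ 2β`. -/
lemma tvDist_le_of_ofReal_exp_neg_le {X : Type*} [MeasurableSpace X] {P Q : Measure X}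
    [IsProbabilityMeasure P] [IsProbabilityMeasure Q] {β : ℝ}
    (h : ENNReal.ofReal (Real.exp (-β)) ≤ hellingerAffinity P Q) :
    tvDist P Q ≤ √(2 * β) := by
  refine (tvDist_le_sqrt P Q).trans (Real.sqrt_le_sqrt ?_)
  have hfin : hellingerAffinity P Q ≠ ∞ :=
    ne_top_of_le_ne_top ENNReal.one_ne_top (hellingerAffinity_le_one P Q)
  have h1 : Real.exp (-β) ≤ (hellingerAffinity P Q).toReal :=
    (ENNReal.ofReal_le_iff_le_toReal hfin).1 h
  have h2 := pow_le_pow_left₀ (Real.exp_pos _).le h1 2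
  rw [← Real.exp_nat_mul] at h2
  have h3 := Real.add_one_le_exp (((2 : ℕ) : ℝ) * -β)
  push_cast at h2 h3
  linarith

end Mixture

/-! ### Explicit constants for small parameters. -/

section Asymptotics

/-- The Bhattacharyya bound for small `x = d ε` and `y = d δ`, where `r = d / n ≤ 1 / 2`. -/
lemma log_mul_le {x y r : ℝ} (hx : 0 ≤ x) (hy : 0 ≤ y) (hx1 : x ≤ 1 / 4) (hy1 : y ≤ 1 / 4)
    (hr : r ≤ 1 / 2) :
    y * Real.exp x < 1 ∧
    Real.log ((Real.exp (x / 2) + Real.exp (-(x / 2))) / (2 * (1 - y * Real.exp x))) *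
      (1 / (1 - r)) ≤ 8 * (x ^ 2 + y) := by
  have he : Real.exp x ≤ 2 := by
    have h1 := Real.exp_bound_div_one_sub_of_interval hx (by linarith)
    refine h1.trans ?_
    rw [div_le_iff₀ (by linarith)]
    linarith
  have ht : y * Real.exp x ≤ 2 * y := by nlinarith
  have ht0 : 0 ≤ y * Real.exp x := by positivity
  generalize y * Real.exp x = t at *
  have ht1 : t ≤ 1 / 2 := by linarith
  refine ⟨by linarith, ?_⟩
  -- The inequality `cosh u ≤ e^(u²/2)` at `u = x / 2` makes the bound quadratic in `x`.
  have hcosh : (Real.exp (x / 2) + Real.exp (-(x / 2))) / 2 ≤ Real.exp (x ^ 2 / 8) := by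
    rw [← Real.cosh_eq]
    refine (Real.cosh_le_exp_half_sq _).trans_eq ?_
    congr 1
    ring
  have hinv : (1 - t)⁻¹ ≤ Real.exp (2 * t) := by
    refine le_trans ?_ (Real.add_one_le_exp _)
    rw [inv_le_iff_one_le_mul₀ (by linarith)]
    nlinarith
  have hlog : Real.log ((Real.exp (x / 2) + Real.exp (-(x / 2))) / (2 * (1 - t))) ≤
      x ^ 2 / 8 + 2 * t := by
    have hpos : 0 < 1 - t := by linarith
    rw [Real.log_le_iff_le_exp (by positivity), Real.exp_add, ← div_div, div_eq_mul_inv _ (1 - t)]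
    gcongr
  have hr1 : 1 / (1 - r) ≤ 2 := by
    rw [div_le_iff₀ (by linarith)]
    linarith
  have hr2 : 0 ≤ 1 / (1 - r) := one_div_nonneg.2 (by linarith)
  -- The constant 8 comes from the `y` term: `2 t ≤ 4 y`, doubled by `1 / (1 - r) ≤ 2`.
  calc _ ≤ (x ^ 2 / 8 + 2 * t) * (1 / (1 - r)) := by gcongr
    _ ≤ (x ^ 2 / 8 + 2 * t) * 2 := by gcongr
    _ ≤ _ := by nlinarith [sq_nonneg x]

end Asymptotics

end LNDP

open Classical in
theorem mainTheorem7 :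
    (∀ (n d : ℕ), d < n → (∃ G : SimpleGraph (Fin n), G.IsRegularOfDegree d) →
      ∀ (ε δ : ℝ), 0 < ε → 0 ≤ δ → d * δ * Real.exp (d * ε) < 1 →
      ∀ (Y : Type w) [MeasurableSpace Y] (A : Kernel (SimpleGraph (Fin n)) Y) [IsMarkovKernel A],
        LNDP.IsLNDP.{u, v, w} ε δ A →
        LNDP.bhattDist (LNDP.pairLaw d A) (LNDP.pairLawEmpty d A) ≤
          ((Real.log ((Real.exp (d * ε / 2) + Real.exp (-(d * ε / 2))) /
              (2 * (1 - d * δ * Real.exp (d * ε)))) * (1 / (1 - (d : ℝ) / (n : ℝ))) : ℝ) :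
            EReal)) ∧
    (∃ c C : ℝ, 0 < c ∧ 0 < C ∧
      ∀ (n d : ℕ), 0 < n → (d : ℝ) ≤ (n : ℝ) / 2 →
      (∃ G : SimpleGraph (Fin n), G.IsRegularOfDegree d) →
      ∀ (ε δ : ℝ), 0 < ε → 0 ≤ δ → d * ε ≤ c → d * δ ≤ c →
      ∀ (Y : Type w) [MeasurableSpace Y] (A : Kernel (SimpleGraph (Fin n)) Y) [IsMarkovKernel A],
        LNDP.IsLNDP.{u, v, w} ε δ A →
        LNDP.bhattDist (LNDP.pairLaw d A) (LNDP.pairLawEmpty d A) ≤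
            ((C * ((d * ε) ^ 2 + d * δ) : ℝ) : EReal) ∧
          LNDP.tvDist (LNDP.pairLaw d A) (LNDP.pairLawEmpty d A) ≤
            C * (d * ε + Real.sqrt (d * δ))) := by
  refine ⟨fun n d hd hG ε δ hε hδ hδ1 Y _ A _ hA =>
    LNDP.bhattDist_le_of_ofReal_exp_neg_le
      (LNDP.ofReal_exp_neg_le_hellingerAffinity hd hG hε.le hδ hδ1 A hA),
    1 / 4, 8, by norm_num, by norm_num, fun n d hn hdn hG ε δ hε hδ hx hy Y _ A _ hA => ?_⟩
  have hn' : (0 : ℝ) < n := by exact_mod_cast hn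
  have hd : d < n := by
    have : (d : ℝ) < n := by linarith
    exact_mod_cast this
  obtain ⟨hδ1, hβ⟩ := LNDP.log_mul_le (x := d * ε) (y := d * δ) (r := (d : ℝ) / n)
    (by positivity) (by positivity) hx hy (by rw [div_le_iff₀ hn']; linarith)
  have hlow := LNDP.ofReal_exp_neg_le_hellingerAffinity hd hG hε.le hδ hδ1 A hA
  have := LNDP.isProbabilityMeasure_regularGraphLaw hG
  have : IsProbabilityMeasure (LNDP.pairLaw d A) := by unfold LNDP.pairLaw; infer_instance
  have : IsProbabilityMeasure (LNDP.pairLawEmpty d A) := by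
    unfold LNDP.pairLawEmpty; infer_instance
  refine ⟨(LNDP.bhattDist_le_of_ofReal_exp_neg_le hlow).trans (EReal.coe_le_coe_iff.2 hβ),
    (LNDP.tvDist_le_of_ofReal_exp_neg_le hlow).trans ?_⟩
  -- Squared, the claim is `16 ((dε)² + dδ) ≤ 64 (dε + √(dδ))²`, so `C = 8` serves both bounds.
  refine Real.sqrt_le_iff.2 ⟨by positivity, ?_⟩
  have hsq : √(d * δ) ^ 2 = d * δ := Real.sq_sqrt (by positivity)
  have hcross : 0 ≤ d * ε * √(d * δ) := by positivity
  have hdδ : (0 : ℝ) ≤ d * δ := by positivity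
  nlinarith [sq_nonneg (d * ε)]
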